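/- Let $b\ge 2$ be an integer, let $W\ge 0$ be a random variable with $\mathbb{E}[W]=1$, and let $W(j_1,\dots,j_k)$, for $k\ge 1$ and $j_1,\dots,j_k\in\{0,\dots,b-1\}$, be independent copies of $W$. For $n\ge 0$ put \[ Y_n = b^{-n}\sum_{j_1,\dots,j_n\in\{0,\dots,b-1\}} W(j_1)\,W(j_1,j_2)\cdots W(j_1,j_2,\dots,j_n). \] Assume that $W$ is not equal in law to the random variable $W_{TC}$ that takes the value $b$ with probability $b^{-1}$ and the value $0$ with probability $1-b^{-1}$. Let $q\ge 2$ be a real number with $\mathbb{E}[W^q]=b^{q-1}$. Then $\mathbb{E}[Y_n^q]<\infty$ for all $n$ and \[ \lim_{n\to\infty}\frac{\log \mathbb{E}[Y_n^q]}{\log n}=1 . \] In fact $\mathbb{E}[Y_n^q]\asymp n$: there are constants $c,C>0$ depending only on $q$, $b$ and $W$ such that $c\,n\le \mathbb{E}[Y_n^q]\le C\,n$ for all $n\ge 1$. -/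

import Mathlib

open MeasureTheory ProbabilityTheory Filter Topology
open scoped ENNReal

noncomputable section

/-- The non-root vertices of the rooted `b`-ary tree: the pair `⟨k, j⟩` is the word
`(j 0, j 1, …, j k)` of length `k + 1` over the alphabet `{0, …, b - 1}`. -/
abbrev CascadeVertex (b : ℕ) : Type := Σ k : ℕ, (Fin (k + 1) → Fin b)

/-- The prefix of length `k + 1` of a word `j` of length `n`, where `k < n`. -/
def wordPrefix {b n : ℕ} (j : Fin n → Fin b) (k : Fin n) : CascadeVertex b :=
  ⟨k, fun i => j (Fin.castLE k.isLt i)⟩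

/-- The total mass of the `n`-th level of the cascade built on the weights `V`:
`b ^ (-n) * ∑ V(j₁) * V(j₁, j₂) * ⋯ * V(j₁, …, jₙ)`, the sum being over all words of length `n`. -/
def cascadeMass {Ω : Type*} {b : ℕ} (V : CascadeVertex b → Ω → ℝ) (n : ℕ) (ω : Ω) : ℝ :=
  ((b : ℝ) ^ n)⁻¹ * ∑ j : Fin n → Fin b, ∏ k : Fin n, V (wordPrefix j k) ω

/-- The family `V` on `(Ω, P)` consists of independent copies of the random variable `W`
on `(Ω₀, P₀)`. -/
structure IsIndepCopies {ι Ω₀ Ω : Type*} [MeasurableSpace Ω₀] [MeasurableSpace Ω]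
    (W : Ω₀ → ℝ) (P₀ : Measure Ω₀) (V : ι → Ω → ℝ) (P : Measure Ω) : Prop where
  measurable : ∀ v, Measurable (V v)
  identDistrib : ∀ v, IdentDistrib (V v) W P P₀
  indep : iIndepFun V P

/-- The law of the totally critical variable: value `b` with probability `1 / b`, and value `0`
with probability `1 - 1 / b`. -/
def totallyCriticalLaw (b : ℕ) : Measure ℝ :=
  (1 - (b : ℝ≥0∞)⁻¹) • Measure.dirac (0 : ℝ) + (b : ℝ≥0∞)⁻¹ • Measure.dirac (b : ℝ)

end

/-! Split the tree at the first letter: `Y_{n+1} = ∑ X_j`, where `X_j` is `W(j)/b` times the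
level-`n` mass of an independent subtree. Let `R_j` be the sum of the other branches, so `X_j` and
`R_j` are independent. With `p = q - 1`, `E[Y_{n+1}^q] = ∑ E[X_j (X_j + R_j)^p]`. The diagonal part
`∑ E[X_j^q]` equals `b^{1-q} E[W^q] E[Y_n^q] = E[Y_n^q]`, so criticality makes the growth exactly
additive; it remains to trap the increment between positive constants.

Above, the cross terms involve only moments of order at most `p < q`. These are bounded in `n`
(`exists_lintegral_levelMass_rpow_le`) because `E[W^s] < b^{s-1}` for `1 < s < q`
(`lintegral_rpow_lt_of_not_totallyCritical`), the one place where the totally critical law is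
excluded. Below, superadditivity of `x ↦ x^p`, valid as `p ≥ 1`, leaves `E[R_j^p]`, which stays away
from zero since `R_j` has mean at least `1/2`. -/

/-! ### Elementary inequalities for real powers -/

section PowerInequalities

/-- Either `r` is at most `δ x` with `(1 + δ)^p = c`, or `x` is at most `r / δ`. Having `c` as close
to 1 as desired preserves a strict contraction. -/
theorem ENNReal.add_rpow_le_const_mul_rpow_add {p c : ℝ} (hp : 0 < p) (hc : 1 < c) :
    ∃ K : ℝ≥0∞, K ≠ ∞ ∧ ∀ x r : ℝ≥0∞, (x + r) ^ p ≤ ENNReal.ofReal c * x ^ p + K * r ^ p := by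
  have hd : 1 < c ^ (1 / p) := Real.one_lt_rpow hc (by positivity)
  obtain ⟨δ, hδ⟩ : ∃ δ : ℝ, δ = c ^ (1 / p) - 1 := ⟨_, rfl⟩
  have hδ0 : 0 < δ := by linarith
  have hcδ : (1 + δ) ^ p = c := by
    rw [hδ, add_sub_cancel, ← Real.rpow_mul (by linarith), one_div_mul_cancel hp.ne', Real.rpow_one]
  refine ⟨ENNReal.ofReal (δ⁻¹ + 1) ^ p, by finiteness, fun x r => ?_⟩
  rcases le_total r (ENNReal.ofReal δ * x) with h | h
  · refine le_trans ?_ le_self_add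
    calc (x + r) ^ p ≤ (ENNReal.ofReal (1 + δ) * x) ^ p := by
          gcongr
          rw [ENNReal.ofReal_add zero_le_one hδ0.le, ENNReal.ofReal_one, add_mul, one_mul]
          gcongr
      _ = ENNReal.ofReal c * x ^ p := by
          rw [ENNReal.mul_rpow_of_nonneg _ _ hp.le, ENNReal.ofReal_rpow_of_pos (by positivity), hcδ]
  · refine le_trans ?_ le_add_self
    rw [← ENNReal.mul_rpow_of_nonneg _ _ hp.le]
    gcongr
    rw [ENNReal.ofReal_add (by positivity) zero_le_one, ENNReal.ofReal_one, add_mul, one_mul]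
    gcongr
    calc x = ENNReal.ofReal δ⁻¹ * (ENNReal.ofReal δ * x) := by
          rw [← mul_assoc, ← ENNReal.ofReal_mul (by positivity), inv_mul_cancel₀ hδ0.ne']
          simp
      _ ≤ _ := by gcongr

/-- Convexity: this is the tangent line to `y ↦ y^p` at `x + r`, obtained from Bernoulli at `-r / (x
+ r)`. -/
theorem Real.add_rpow_le_rpow_add_mul {p x r : ℝ} (hp : 1 ≤ p) (hx : 0 ≤ x) (hr : 0 ≤ r) :
    (x + r) ^ p ≤ x ^ p + p * r * (x + r) ^ (p - 1) := by
  rcases (add_nonneg hx hr).eq_or_lt with h | h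
  · obtain rfl : x = 0 := by linarith
    obtain rfl : r = 0 := by linarith
    simp
  · have h1 : 1 + p * (-(r / (x + r))) ≤ (1 + -(r / (x + r))) ^ p :=
      one_add_mul_self_le_rpow_one_add (by
        rw [neg_le_neg_iff, div_le_one h]; linarith) hp
    have h2 : 1 + -(r / (x + r)) = x / (x + r) := by field_simp; ring
    rw [h2, Real.div_rpow hx h.le, le_div_iff₀ (Real.rpow_pos_of_pos h p)] at h1
    have h3 : (x + r) ^ p = (x + r) ^ (p - 1) * (x + r) := by
      rw [← Real.rpow_add_one h.ne', sub_add_cancel]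
    have h4 : (1 + p * -(r / (x + r))) * (x + r) ^ p
        = (x + r) ^ p - p * r * (x + r) ^ (p - 1) := by
      rw [h3]; field_simp; ring
    linarith

theorem ENNReal.add_rpow_le_rpow_add_mul {p : ℝ} (hp : 1 ≤ p) (x r : ℝ≥0∞) :
    (x + r) ^ p ≤ x ^ p + ENNReal.ofReal p * r * (x + r) ^ (p - 1) := by
  have hp0 : 0 < p := by linarith
  rcases eq_or_ne x ∞ with rfl | hx
  · simp [ENNReal.top_rpow_of_pos hp0]
  rcases eq_or_ne r ∞ with rfl | hr
  · have : (∞ : ℝ≥0∞) ^ (p - 1) ≠ 0 := by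
      rcases hp.eq_or_lt with rfl | h
      · simp
      · rw [ENNReal.top_rpow_of_pos (by linarith)]; simp
    have h2 : ENNReal.ofReal p * ∞ * (x + ∞) ^ (p - 1) = ∞ := by
      rw [add_top, ENNReal.mul_top (by simpa using hp0), ENNReal.top_mul this]
    rw [h2]; simp
  lift x to NNReal using hx
  lift r to NNReal using hr
  have h := Real.add_rpow_le_rpow_add_mul hp x.2 r.2
  have h1 : 0 ≤ p - 1 := by linarith
  rw [← ENNReal.coe_add, ← ENNReal.coe_rpow_of_nonneg _ hp0.le, ← ENNReal.coe_rpow_of_nonneg _ h1,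
    ← ENNReal.coe_rpow_of_nonneg _ hp0.le, ENNReal.ofReal, ← ENNReal.coe_mul, ← ENNReal.coe_mul,
    ← ENNReal.coe_add, ENNReal.coe_le_coe, ← NNReal.coe_le_coe]
  push_cast
  rw [Real.coe_toNNReal _ hp0.le]
  exact h

theorem ENNReal.add_rpow_le_two_rpow_mul {p : ℝ} (hp : 0 ≤ p) (x r : ℝ≥0∞) :
    (x + r) ^ p ≤ 2 ^ p * (x ^ p + r ^ p) := by
  rcases le_total x r with h | h
  · calc (x + r) ^ p ≤ (2 * r) ^ p := by gcongr; rw [two_mul]; gcongr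
      _ = 2 ^ p * r ^ p := ENNReal.mul_rpow_of_nonneg _ _ hp
      _ ≤ _ := by gcongr; exact le_add_self
  · calc (x + r) ^ p ≤ (2 * x) ^ p := by gcongr; rw [two_mul]; gcongr
      _ = 2 ^ p * x ^ p := ENNReal.mul_rpow_of_nonneg _ _ hp
      _ ≤ _ := by gcongr; exact le_self_add

theorem ENNReal.mul_rpow_sub_one (x : ℝ≥0∞) {p : ℝ} (hp : 1 ≤ p) :
    x * x ^ (p - 1) = x ^ p := by
  conv_lhs => rw [← ENNReal.rpow_one x, ← ENNReal.rpow_mul, one_mul]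
  rw [← ENNReal.rpow_add_of_nonneg _ _ zero_le_one (by linarith), add_sub_cancel]

/-- At the critical exponent the leading coefficient must be exactly 1; the errors then carry each
variable to power at most `p`. -/
theorem ENNReal.mul_add_rpow_le {p : ℝ} (hp : 1 ≤ p) (x r : ℝ≥0∞) :
    x * (x + r) ^ p ≤
      x ^ (p + 1) + ENNReal.ofReal p * 2 ^ (p - 1) * (x ^ p * r + x * r ^ p) := by
  have hx : x ^ (p + 1) = x * x ^ p := by
    have := ENNReal.mul_rpow_sub_one x (p := p + 1) (by linarith)
    rw [← this, add_sub_cancel_right]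
  calc x * (x + r) ^ p
      ≤ x * (x ^ p + ENNReal.ofReal p * r * (2 ^ (p - 1) * (x ^ (p - 1) + r ^ (p - 1)))) := by
        gcongr
        refine (ENNReal.add_rpow_le_rpow_add_mul hp x r).trans ?_
        gcongr
        exact ENNReal.add_rpow_le_two_rpow_mul (by linarith) x r
    _ = x * x ^ p + ENNReal.ofReal p * 2 ^ (p - 1) *
          ((x * x ^ (p - 1)) * r + x * (r * r ^ (p - 1))) := by ring
    _ = _ := by rw [ENNReal.mul_rpow_sub_one x hp, ENNReal.mul_rpow_sub_one r hp, hx]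

/-- Strict concavity of `v ↦ v^t` at `v = u^(q-1)`, multiplied by `u`. The excluded points 0 and 1
are the equality cases. -/
theorem Real.rpow_lt_convex_comb {u s q t : ℝ} (hs : 1 < s) (ht0 : 0 < t) (ht1 : t < 1)
    (hst : s = (1 - t) + t * q) (hu : 0 ≤ u) (hu0 : u ≠ 0) (hu1 : u ≠ 1) :
    u ^ s < (1 - t) * u + t * u ^ q := by
  have hu' : 0 < u := lt_of_le_of_ne hu (Ne.symm hu0)
  have hq : q - 1 ≠ 0 := by
    intro h
    have : q = 1 := by linarith
    subst this
    linarith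
  have hv : u ^ (q - 1) ≠ 1 := by
    intro h
    have h' := congrArg Real.log h
    rw [Real.log_rpow hu', Real.log_one] at h'
    exact hu1 (Real.eq_one_of_pos_of_log_eq_zero hu' ((mul_eq_zero.1 h').resolve_left hq))
  have h := rpow_one_add_lt_one_add_mul_self (s := u ^ (q - 1) - 1)
    (by linarith [Real.rpow_nonneg hu (q - 1)]) (sub_ne_zero.2 hv) ht0 ht1
  rw [add_sub_cancel, ← Real.rpow_mul hu] at h
  have e1 : u ^ s = u * u ^ ((q - 1) * t) := by
    rw [← Real.rpow_one_add' hu (by nlinarith)]; congr 1; rw [hst]; ring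
  have e2 : u ^ q = u * u ^ (q - 1) := by
    conv_rhs => rw [← Real.rpow_one u, ← Real.rpow_mul hu, one_mul]
    rw [← Real.rpow_add hu']; congr 1; ring
  rw [e1, e2]
  nlinarith [mul_lt_mul_of_pos_left h hu']

end PowerInequalities

/-! ### Strict subcriticality below the exponent `q` -/

section Law

theorem MeasureTheory.Measure.eq_totallyCriticalLaw {b : ℕ} (hb : b ≠ 0) (ν : Measure ℝ)
    [IsProbabilityMeasure ν] (hν : ∀ᵐ x : ℝ ∂ν, x = 0 ∨ x = b)
    (hmean : ∫⁻ x, ENNReal.ofReal x ∂ν = 1) : ν = totallyCriticalLaw b := by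
  have hb' : (b : ℝ) ≠ 0 := by exact_mod_cast hb
  have h1 : ν = ν {0} • Measure.dirac (0 : ℝ) + ν {(b : ℝ)} • Measure.dirac (b : ℝ) := by
    rw [← Measure.restrict_singleton, ← Measure.restrict_singleton, ← Measure.restrict_union
      (by simpa using hb'.symm) (measurableSet_singleton _)]
    exact (Measure.restrict_eq_self_of_ae_mem (by simpa [or_comm] using hν)).symm
  have h2 : ν {(b : ℝ)} = (b : ℝ≥0∞)⁻¹ := by
    rw [h1, lintegral_add_measure, lintegral_smul_measure, lintegral_smul_measure,
      lintegral_dirac, lintegral_dirac] at hmean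
    simp only [ENNReal.ofReal_zero, mul_zero, zero_add, ENNReal.ofReal_natCast, smul_eq_mul]
      at hmean
    exact ENNReal.eq_inv_of_mul_eq_one_left hmean
  have h3 : ν {0} = 1 - (b : ℝ≥0∞)⁻¹ := by
    have h := congrArg (fun m : Measure ℝ => m Set.univ) h1
    simp only [measure_univ, Measure.add_apply, Measure.smul_apply, smul_eq_mul, mul_one, h2] at h
    rw [h, ENNReal.add_sub_cancel_right (by simpa using hb)]
  rw [h1, h2, h3]; rfl

/-- For `u = W / b` both `E[u]` and `E[u^q]` equal `1/b`, so interpolation gives `E[u^s] ≤ 1/b`.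
Equality would force `u ∈ {0, 1}` almost surely, and the mean would then determine the excluded law.
-/
theorem lintegral_rpow_lt_of_not_totallyCritical {b : ℕ} (hb : 2 ≤ b)
    {Ω₀ : Type*} [MeasurableSpace Ω₀] (P₀ : Measure Ω₀) [IsProbabilityMeasure P₀]
    (W : Ω₀ → ℝ) (hW_meas : Measurable W) (hW_nonneg : ∀ᵐ x ∂P₀, 0 ≤ W x)
    (hW_int : Integrable W P₀) (hW_mean : ∫ x, W x ∂P₀ = 1)
    (hW_not_critical : P₀.map W ≠ totallyCriticalLaw b)
    (q : ℝ) (hWq_int : Integrable (fun x => W x ^ q) P₀)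
    (hWq : ∫ x, W x ^ q ∂P₀ = (b : ℝ) ^ (q - 1)) {s : ℝ} (hs : 1 < s) (hsq : s < q) :
    ∫⁻ x, ENNReal.ofReal (W x) ^ s ∂P₀ < (b : ℝ≥0∞) ^ (s - 1) := by
  have hb0 : (0 : ℝ) < b := by exact_mod_cast (by omega : 0 < b)
  have hq1 : 0 < q - 1 := by linarith
  obtain ⟨t, ht⟩ : ∃ t : ℝ, t = (s - 1) / (q - 1) := ⟨_, rfl⟩
  have ht0 : 0 < t := by rw [ht]; exact div_pos (by linarith) hq1
  have ht1 : t < 1 := by rw [ht, div_lt_one hq1]; linarith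
  have hst : s = (1 - t) + t * q := by rw [ht]; field_simp; ring
  have key : ∀ u : ℝ, 0 ≤ u → u ^ s ≤ (1 - t) * u + t * u ^ q := by
    intro u hu
    rcases eq_or_ne u 0 with rfl | hu0
    · rw [Real.zero_rpow (by linarith), Real.zero_rpow (by linarith)]; simp
    rcases eq_or_ne u 1 with rfl | hu1
    · simp
    exact (Real.rpow_lt_convex_comb hs ht0 ht1 hst hu hu0 hu1).le
  have hdiv : ∀ᵐ x ∂P₀, ∀ r : ℝ, (W x / b) ^ r = W x ^ r / (b : ℝ) ^ r := by
    filter_upwards [hW_nonneg] with x hx r using Real.div_rpow hx hb0.le r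
  have hI1 : Integrable (fun x => (1 - t) * (W x / b)) P₀ := (hW_int.div_const _).const_mul _
  have hI2' : Integrable (fun x => (W x / b) ^ q) P₀ := by
    refine (hWq_int.div_const ((b : ℝ) ^ q)).congr ?_
    filter_upwards [hdiv] with x hx using (hx q).symm
  have hI2 : Integrable (fun x => t * (W x / b) ^ q) P₀ := hI2'.const_mul _
  have hI12 := hI1.add hI2
  have hI3 : Integrable (fun x => (W x / b) ^ s) P₀ := by
    refine hI12.mono' ((hW_meas.div_const _).pow_const s).aestronglyMeasurable ?_
    filter_upwards [hW_nonneg] with x hx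
    have hx' : 0 ≤ W x / b := by positivity
    rw [Real.norm_of_nonneg (by positivity)]
    exact key _ hx'
  have hIq : ∫ x, (W x / b) ^ q ∂P₀ = (b : ℝ)⁻¹ := by
    rw [integral_congr_ae (g := fun x => W x ^ q / (b : ℝ) ^ q)
      (by filter_upwards [hdiv] with x hx using hx q), integral_div, hWq,
      Real.rpow_sub_one hb0.ne']
    field_simp
  have hsum : ∫ x, ((1 - t) * (W x / b) + t * (W x / b) ^ q) ∂P₀ = (b : ℝ)⁻¹ := by
    rw [integral_add hI1 hI2, integral_const_mul, integral_const_mul, integral_div, hW_mean, hIq]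
    ring
  have hlt : ∫ x, (W x / b) ^ s ∂P₀ < (b : ℝ)⁻¹ := by
    have hnn : 0 ≤ᵐ[P₀] fun x => ((1 - t) * (W x / b) + t * (W x / b) ^ q) - (W x / b) ^ s := by
      filter_upwards [hW_nonneg] with x hx
      have := key (W x / b) (by positivity)
      simpa using this
    have hint := integral_sub hI12 hI3
    simp only [Pi.add_apply] at hint
    rw [hsum] at hint
    rcases (integral_nonneg_of_ae hnn).eq_or_lt with h0 | h0
    · exfalso
      have hz := (integral_eq_zero_iff_of_nonneg_ae hnn (hI12.sub hI3)).1 h0.symm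
      refine hW_not_critical ?_
      have : IsProbabilityMeasure (P₀.map W) :=
        Measure.isProbabilityMeasure_map hW_meas.aemeasurable
      refine Measure.eq_totallyCriticalLaw (by omega) _ ?_ ?_
      · refine (ae_map_iff hW_meas.aemeasurable (p := fun x : ℝ => x = 0 ∨ x = b)
          ((measurableSet_singleton (0 : ℝ)).union (measurableSet_singleton (b : ℝ)))).2 ?_
        filter_upwards [hz, hW_nonneg] with x hx hx0
        by_contra hcon
        push Not at hcon
        have := Real.rpow_lt_convex_comb (u := W x / b) hs ht0 ht1 hst (by positivity)
          (div_ne_zero hcon.1 hb0.ne') (by rw [Ne, div_eq_one_iff_eq hb0.ne']; exact hcon.2)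
        simp only [Pi.zero_apply] at hx
        linarith
      · rw [lintegral_map (by fun_prop) hW_meas,
          ← ofReal_integral_eq_lintegral_ofReal hW_int hW_nonneg, hW_mean, ENNReal.ofReal_one]
    · linarith
  have e : ∫⁻ x, ENNReal.ofReal (W x) ^ s ∂P₀
      = ENNReal.ofReal ((b : ℝ) ^ s * ∫ x, (W x / b) ^ s ∂P₀) := by
    rw [← integral_const_mul, ofReal_integral_eq_lintegral_ofReal (hI3.const_mul _)]
    · refine lintegral_congr_ae ?_
      filter_upwards [hW_nonneg, hdiv] with x hx hx'
      rw [hx', mul_div_cancel₀ _ (by positivity), ENNReal.ofReal_rpow_of_nonneg hx (by linarith)]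
    · filter_upwards [hW_nonneg] with x hx
      simp only [Pi.zero_apply]; positivity
  rw [e, ← ENNReal.ofReal_natCast, ENNReal.ofReal_rpow_of_pos hb0,
    ENNReal.ofReal_lt_ofReal_iff (by positivity), Real.rpow_sub_one hb0.ne', div_eq_mul_inv]
  gcongr

end Law

/-! ### The recursion at the first letter and independence of branches -/

section Cascade

/-- The vertex given by the word of length one with letter `j`. -/
def rootVertex {b : ℕ} (j : Fin b) : CascadeVertex b := ⟨0, fun _ => j⟩

/-- The vertex obtained from `v` by putting the letter `j` in front. -/
def childVertex {b : ℕ} (j : Fin b) (v : CascadeVertex b) : CascadeVertex b :=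
  ⟨v.1 + 1, Fin.cons j v.2⟩

/-- The first letter of the word `v`. -/
def headLetter {b : ℕ} (v : CascadeVertex b) : Fin b := v.2 0

/-- The mass of the `n`-th level of the cascade with weights in `ℝ≥0∞`, defined by decomposition
at the first letter. -/
noncomputable def levelMass {Ω : Type*} {b : ℕ} :
    ℕ → (CascadeVertex b → Ω → ℝ≥0∞) → Ω → ℝ≥0∞
  | 0, _, _ => 1
  | n + 1, U, ω =>
      ∑ j, U (rootVertex j) ω / b * levelMass n (fun v => U (childVertex j v)) ω

/-- The contribution of the words with first letter `j` to the mass of level `n + 1`. -/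
noncomputable def branchMass {Ω : Type*} {b : ℕ} (n : ℕ) (U : CascadeVertex b → Ω → ℝ≥0∞)
    (j : Fin b) (ω : Ω) : ℝ≥0∞ :=
  U (rootVertex j) ω / b * levelMass n (fun v => U (childVertex j v)) ω

/-- The contribution of the words with first letter different from `j` to the mass of level
`n + 1`. -/
noncomputable def restMass {Ω : Type*} {b : ℕ} (n : ℕ) (U : CascadeVertex b → Ω → ℝ≥0∞)
    (j : Fin b) (ω : Ω) : ℝ≥0∞ :=
  ∑ i ∈ Finset.univ.erase j, branchMass n U i ω

variable {Ω : Type*} {b : ℕ}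

theorem childVertex_injective (j : Fin b) : Function.Injective (childVertex j) := by
  rintro ⟨k, f⟩ ⟨l, g⟩ h
  simp only [childVertex, Sigma.mk.injEq, add_left_inj] at h
  obtain ⟨rfl, h⟩ := h
  rw [heq_eq_eq, Fin.cons_inj] at h
  rw [h.2]

theorem levelMass_succ (n : ℕ) (U : CascadeVertex b → Ω → ℝ≥0∞) (ω : Ω) :
    levelMass (n + 1) U ω = ∑ j, branchMass n U j ω := rfl

theorem levelMass_succ_eq_add (n : ℕ) (U : CascadeVertex b → Ω → ℝ≥0∞) (j : Fin b) (ω : Ω) :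
    levelMass (n + 1) U ω = branchMass n U j ω + restMass n U j ω := by
  exact (Finset.add_sum_erase _ (fun i => branchMass n U i ω) (Finset.mem_univ j)).symm

theorem cascadeMass_zero (V : CascadeVertex b → Ω → ℝ) (ω : Ω) : cascadeMass V 0 ω = 1 := by
  simp [cascadeMass]

theorem cascadeMass_succ (V : CascadeVertex b → Ω → ℝ) (n : ℕ) (ω : Ω) :
    cascadeMass V (n + 1) ω =
      ∑ j, V (rootVertex j) ω / b * cascadeMass (fun v => V (childVertex j v)) n ω := by
  have h : ∀ (j : Fin b) (w : Fin n → Fin b),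
      ∏ k, V (wordPrefix (Fin.cons j w : Fin (n + 1) → Fin b) k) ω =
        V (rootVertex j) ω * ∏ k, V (childVertex j (wordPrefix w k)) ω := by
    intro j w
    rw [Fin.prod_univ_succ]
    congr 1
    · congr 1
      simp only [wordPrefix, rootVertex, Fin.val_zero, Sigma.mk.injEq, heq_eq_eq, true_and]
      funext i
      obtain rfl : i = 0 := Fin.eq_zero i
      rfl
    · refine Finset.prod_congr rfl fun k _ => ?_
      congr 1
      simp only [wordPrefix, childVertex]
      congr 1
      funext i
      refine Fin.cases ?_ (fun i => ?_) i
      · rfl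
      · rfl
  rw [cascadeMass, ← (Fin.consEquiv fun _ => Fin b).sum_comp, Fintype.sum_prod_type, Finset.mul_sum]
  refine Finset.sum_congr rfl fun j _ => ?_
  have h' : ∀ w : Fin n → Fin b, ∏ k, V (wordPrefix ((Fin.consEquiv fun _ => Fin b) (j, w)) k) ω =
      V (rootVertex j) ω * ∏ k, V (childVertex j (wordPrefix w k)) ω := h j
  simp only [h', cascadeMass, ← Finset.mul_sum, pow_succ, mul_inv]
  ring

theorem cascadeMass_nonneg_and_ofReal (n : ℕ) (ω : Ω) :
    ∀ V : CascadeVertex b → Ω → ℝ, (∀ v, 0 ≤ V v ω) →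
      0 ≤ cascadeMass V n ω ∧ ENNReal.ofReal (cascadeMass V n ω) =
        levelMass n (fun v ω => ENNReal.ofReal (V v ω)) ω := by
  induction n with
  | zero => intro V hV; simp [cascadeMass_zero, levelMass]
  | succ n ih =>
    intro V hV
    have hj : ∀ j : Fin b,
        0 ≤ V (rootVertex j) ω / b * cascadeMass (fun v => V (childVertex j v)) n ω := fun j =>
      mul_nonneg (div_nonneg (hV _) (Nat.cast_nonneg _)) (ih _ fun v => hV _).1
    rw [cascadeMass_succ]
    refine ⟨Finset.sum_nonneg fun j _ => hj j, ?_⟩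
    rw [ENNReal.ofReal_sum_of_nonneg fun j _ => hj j, levelMass]
    refine Finset.sum_congr rfl fun j _ => ?_
    have hb : (0 : ℝ) < b := by exact_mod_cast j.pos
    rw [ENNReal.ofReal_mul (div_nonneg (hV _) (Nat.cast_nonneg _)), ENNReal.ofReal_div_of_pos hb,
      ENNReal.ofReal_natCast, (ih _ fun v => hV _).2]

theorem measurable_levelMass (m : MeasurableSpace Ω) (n : ℕ) :
    ∀ U : CascadeVertex b → Ω → ℝ≥0∞, (∀ v, Measurable (U v)) → Measurable (levelMass n U) := by
  induction n with
  | zero => intro U _; exact measurable_const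
  | succ n ih =>
    intro U hU
    exact Finset.measurable_fun_sum _ fun j _ =>
      ((hU _).div_const _).mul (ih _ fun v => hU _)

/-- The weights `U` are independent and have the common moment function `m`. -/
structure IsMomentCascade [MeasurableSpace Ω] (U : CascadeVertex b → Ω → ℝ≥0∞) (m : ℝ → ℝ≥0∞)
    (P : Measure Ω) : Prop where
  measurable : ∀ v, Measurable (U v)
  indep : iIndepFun U P
  moment : ∀ v s, ∫⁻ ω, U v ω ^ s ∂P = m s

/-- The σ-algebra generated by the weights with indices in `S`. -/
abbrev weightSigma (U : CascadeVertex b → Ω → ℝ≥0∞) (S : Set (CascadeVertex b)) :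
    MeasurableSpace Ω :=
  ⨆ v ∈ S, MeasurableSpace.comap (U v) inferInstance

theorem measurable_weightSigma (U : CascadeVertex b → Ω → ℝ≥0∞) {S : Set (CascadeVertex b)}
    {v : CascadeVertex b} (hv : v ∈ S) : Measurable[weightSigma U S] (U v) :=
  (comap_measurable (U v)).mono (le_iSup₂ (f := fun v (_ : v ∈ S) =>
    MeasurableSpace.comap (U v) inferInstance) v hv) le_rfl

theorem measurable_branchMass_weightSigma (U : CascadeVertex b → Ω → ℝ≥0∞)
    {S : Set (CascadeVertex b)} (n : ℕ) {j : Fin b} (hS : ∀ v, headLetter v = j → v ∈ S) :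
    Measurable[weightSigma U S] (branchMass n U j) := by
  have h1 : Measurable[weightSigma U S] (U (rootVertex j)) :=
    measurable_weightSigma U (hS _ rfl)
  have h2 : Measurable[weightSigma U S] (levelMass n fun v => U (childVertex j v)) :=
    measurable_levelMass _ n _ fun v => measurable_weightSigma U (hS _ rfl)
  exact Measurable.mul (Measurable.div_const h1 _) h2

theorem measurable_restMass_weightSigma (U : CascadeVertex b → Ω → ℝ≥0∞) (n : ℕ) (j : Fin b) :
    Measurable[weightSigma U {v | headLetter v ≠ j}] (restMass n U j) :=
  Finset.measurable_fun_sum _ fun _ hi => measurable_branchMass_weightSigma U n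
    fun _ hv hv' => Finset.ne_of_mem_erase hi (hv.symm.trans hv')

namespace IsMomentCascade

variable [MeasurableSpace Ω] {P : Measure Ω} {U : CascadeVertex b → Ω → ℝ≥0∞} {m : ℝ → ℝ≥0∞}

/-- Subtrees keep the same moment function, so inductions over all `U` have constants independent of
the subtree. -/
theorem child (h : IsMomentCascade U m P) (j : Fin b) :
    IsMomentCascade (fun v => U (childVertex j v)) m P where
  measurable _ := h.measurable _
  indep := h.indep.precomp (childVertex_injective j)
  moment _ := h.moment _

theorem lintegral_mul (h : IsMomentCascade U m P) {S T : Set (CascadeVertex b)}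
    (hST : Disjoint S T) {f g : Ω → ℝ≥0∞} (hf : Measurable[weightSigma U S] f)
    (hg : Measurable[weightSigma U T] g) :
    ∫⁻ ω, f ω * g ω ∂P = (∫⁻ ω, f ω ∂P) * ∫⁻ ω, g ω ∂P :=
  lintegral_mul_eq_lintegral_mul_lintegral_of_independent_measurableSpace
    (iSup₂_le fun v _ => (h.measurable v).comap_le)
    (iSup₂_le fun v _ => (h.measurable v).comap_le)
    (indep_iSup_of_disjoint (fun v => (h.measurable v).comap_le) h.indep.iIndep hST) hf hg

/-- The two masses use disjoint sets of weights: words beginning with `j`, and all others. -/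
theorem lintegral_branchMass_mul_restMass (h : IsMomentCascade U m P) (n : ℕ) (j : Fin b)
    {f g : ℝ≥0∞ → ℝ≥0∞} (hf : Measurable f) (hg : Measurable g) :
    ∫⁻ ω, f (branchMass n U j ω) * g (restMass n U j ω) ∂P =
      (∫⁻ ω, f (branchMass n U j ω) ∂P) * ∫⁻ ω, g (restMass n U j ω) ∂P :=
  h.lintegral_mul (S := {v | headLetter v = j}) (T := {v | headLetter v ≠ j})
    (Set.disjoint_left.2 fun _ hv hv' => hv' hv)
    (hf.comp (measurable_branchMass_weightSigma U n fun _ hv => hv))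
    (hg.comp (measurable_restMass_weightSigma U n j))

theorem lintegral_branchMass_rpow (h : IsMomentCascade U m P) (n : ℕ) (j : Fin b) {s : ℝ}
    (hs : 0 ≤ s) :
    ∫⁻ ω, branchMass n U j ω ^ s ∂P =
      m s / (b : ℝ≥0∞) ^ s * ∫⁻ ω, levelMass n (fun v => U (childVertex j v)) ω ^ s ∂P := by
  have hdisj : Disjoint ({rootVertex j} : Set (CascadeVertex b)) (Set.range (childVertex j)) := by
    rw [Set.disjoint_singleton_left]
    rintro ⟨v, hv⟩
    have := congrArg Sigma.fst hv
    simp [childVertex, rootVertex] at this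
  have h1 : Measurable[weightSigma U {rootVertex j}]
      fun ω => (U (rootVertex j) ω / (b : ℝ≥0∞)) ^ s :=
    ((measurable_weightSigma U (Set.mem_singleton _)).div_const _).pow_const s
  have h2 : Measurable[weightSigma U (Set.range (childVertex j))]
      fun ω => levelMass n (fun v => U (childVertex j v)) ω ^ s :=
    (measurable_levelMass _ n _ fun v => measurable_weightSigma U (Set.mem_range_self v)).pow_const s
  simp only [branchMass, ENNReal.mul_rpow_of_nonneg _ _ hs]
  rw [h.lintegral_mul hdisj h1 h2]
  congr 1
  simp only [ENNReal.div_rpow_of_nonneg _ _ hs]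
  simp only [div_eq_mul_inv]
  rw [lintegral_mul_const _ ((h.measurable _).pow_const s), h.moment]

theorem measurable_branchMass (h : IsMomentCascade U m P) (n : ℕ) (j : Fin b) :
    Measurable (branchMass n U j) :=
  ((h.measurable _).div_const _).mul (measurable_levelMass _ n _ fun _ => h.measurable _)

theorem measurable_restMass (h : IsMomentCascade U m P) (n : ℕ) (j : Fin b) :
    Measurable (restMass n U j) :=
  Finset.measurable_fun_sum _ fun i _ => h.measurable_branchMass n i

theorem lintegral_levelMass [IsProbabilityMeasure P] (hb : b ≠ 0) (hm : m 1 = 1) (n : ℕ) :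
    ∀ {U : CascadeVertex b → Ω → ℝ≥0∞}, IsMomentCascade U m P → ∫⁻ ω, levelMass n U ω ∂P = 1 := by
  induction n with
  | zero => intro U _; simp [levelMass]
  | succ n ih =>
    intro U h
    simp only [levelMass_succ]
    rw [lintegral_finsetSum _ fun j _ => h.measurable_branchMass n j]
    have hj : ∀ j, ∫⁻ ω, branchMass n U j ω ∂P = (b : ℝ≥0∞)⁻¹ := by
      intro j
      have := h.lintegral_branchMass_rpow n j zero_le_one
      simpa [hm, ih (h.child j)] using this
    simp only [hj, Finset.sum_const, Finset.card_univ, Fintype.card_fin, nsmul_eq_mul]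
    exact ENNReal.mul_inv_cancel (by exact_mod_cast hb) (by simp)

theorem lintegral_branchMass [IsProbabilityMeasure P] (h : IsMomentCascade U m P) (hb : b ≠ 0)
    (hm : m 1 = 1) (n : ℕ) (j : Fin b) : ∫⁻ ω, branchMass n U j ω ∂P = (b : ℝ≥0∞)⁻¹ := by
  have := h.lintegral_branchMass_rpow n j zero_le_one
  simpa [hm, lintegral_levelMass hb hm n (h.child j)] using this

/-- Expanding only one factor of the mass as a sum over branches pairs each branch with its
independent complement, also for non-integer exponents. -/
theorem lintegral_levelMass_succ_rpow (h : IsMomentCascade U m P) (n : ℕ) {p : ℝ} (hp : 0 ≤ p) :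
    ∫⁻ ω, levelMass (n + 1) U ω ^ (p + 1) ∂P =
      ∑ j, ∫⁻ ω, branchMass n U j ω * (branchMass n U j ω + restMass n U j ω) ^ p ∂P := by
  have hmeas : ∀ j, Measurable fun ω =>
      branchMass n U j ω * (branchMass n U j ω + restMass n U j ω) ^ p := fun j =>
    (h.measurable_branchMass n j).mul
      (((h.measurable_branchMass n j).add (h.measurable_restMass n j)).pow_const p)
  rw [← lintegral_finsetSum _ fun j _ => hmeas j]
  refine lintegral_congr fun ω => ?_
  simp only [← levelMass_succ_eq_add, ← Finset.sum_mul, ← levelMass_succ]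
  have := ENNReal.mul_rpow_sub_one (levelMass (n + 1) U ω) (p := p + 1) (by linarith)
  rw [← this, add_sub_cancel_right]

theorem lintegral_restMass_rpow_le (U : CascadeVertex b → Ω → ℝ≥0∞) (n : ℕ) (j : Fin b) {p : ℝ}
    (hp : 0 ≤ p) :
    ∫⁻ ω, restMass n U j ω ^ p ∂P ≤ ∫⁻ ω, levelMass (n + 1) U ω ^ p ∂P := by
  gcongr with ω
  rw [levelMass_succ_eq_add n U j]
  exact le_add_self

theorem lintegral_branchMass_rpow_le (U : CascadeVertex b → Ω → ℝ≥0∞) (n : ℕ) (j : Fin b) {p : ℝ}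
    (hp : 0 ≤ p) :
    ∫⁻ ω, branchMass n U j ω ^ p ∂P ≤ ∫⁻ ω, levelMass (n + 1) U ω ^ p ∂P := by
  gcongr with ω
  rw [levelMass_succ_eq_add n U j]
  exact le_self_add

end IsMomentCascade

end Cascade

/-! ### Bounded subcritical moments and linear growth at criticality -/

section MomentBounds

universe u

theorem ENNReal.rpow_le_one_add {s : ℝ} (hs0 : 0 ≤ s) (hs1 : s ≤ 1) (x : ℝ≥0∞) :
    x ^ s ≤ 1 + x := by
  rcases le_total x 1 with h | h
  · exact (ENNReal.rpow_le_one h hs0).trans le_self_add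
  · calc x ^ s ≤ x ^ (1 : ℝ) := ENNReal.rpow_le_rpow_of_exponent_le h hs1
      _ = x := ENNReal.rpow_one x
      _ ≤ _ := le_add_self

/-- Turns a mean of at least `1/2` into a lower bound on the `p`-th moment; the threshold `1/4`
costs only half of that mean. -/
theorem ENNReal.le_inv_four_add {p : ℝ} (hp : 1 ≤ p) (x : ℝ≥0∞) :
    x ≤ 4⁻¹ + 4 ^ (p - 1) * x ^ p := by
  have hp' : 0 ≤ p - 1 := by linarith
  rcases le_total x 4⁻¹ with h | h
  · exact h.trans le_self_add
  · refine le_trans ?_ le_add_self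
    have h1 : 1 ≤ 4 * x := by
      calc (1 : ℝ≥0∞) = 4 * 4⁻¹ := (ENNReal.mul_inv_cancel (by simp) (by simp)).symm
        _ ≤ 4 * x := by gcongr
    rw [← ENNReal.mul_rpow_sub_one x hp]
    calc x = x * 1 := (mul_one x).symm
      _ ≤ x * (4 * x) ^ (p - 1) := by gcongr; simpa using ENNReal.rpow_le_rpow h1 hp'
      _ = _ := by rw [ENNReal.mul_rpow_of_nonneg _ _ hp']; ring

theorem ENNReal.exists_one_lt_mul_lt_one {r : ℝ≥0∞} (hr : r < 1) :
    ∃ c : ℝ, 1 < c ∧ ENNReal.ofReal c * r < 1 := by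
  lift r to NNReal using (hr.trans ENNReal.one_lt_top).ne
  have hr' : (r : ℝ) < 1 := by exact_mod_cast hr
  have hr0 : (0 : ℝ) ≤ r := r.2
  refine ⟨2 / (1 + r), by rw [lt_div_iff₀ (by linarith)]; linarith, ?_⟩
  rw [← ENNReal.ofReal_coe_nnreal, ← ENNReal.ofReal_mul (by positivity), ENNReal.ofReal_lt_one,
    div_mul_eq_mul_div, div_lt_one (by linarith)]
  linarith

theorem ENNReal.exists_affine_bound {g k : ℝ≥0∞} (hg : g < 1) (hk : k ≠ ∞) :
    ∃ A : ℝ≥0∞, A ≠ ∞ ∧ 1 ≤ A ∧ g * A + k ≤ A := by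
  have h1 : 1 - g ≠ 0 := (tsub_pos_of_lt hg).ne'
  have h2 : 1 - g ≠ ∞ := by finiteness
  -- Fixed point of `A ↦ g A + (k + 1)`; the extra 1 ensures `1 ≤ A`, to cover level 0.
  obtain ⟨A, hA⟩ : ∃ A, A = (1 - g)⁻¹ * (k + 1) := ⟨_, rfl⟩
  have h3 : A = g * A + (k + 1) := by
    calc A = (g + (1 - g)) * A := by rw [add_tsub_cancel_of_le hg.le, one_mul]
      _ = g * A + (1 - g) * A := add_mul _ _ _
      _ = _ := by
        congr 1
        rw [hA, ← mul_assoc, ENNReal.mul_inv_cancel h1 h2, one_mul]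
  refine ⟨A, ?_, ?_, ?_⟩
  · rw [hA]
    exact ENNReal.mul_ne_top (by simpa using h1) (by finiteness)
  · rw [h3, ← add_assoc]; exact le_add_self
  · conv_rhs => rw [h3, ← add_assoc]
    exact le_self_add

theorem ENNReal.natCast_mul_div_rpow {b : ℕ} (hb : b ≠ 0) {s : ℝ} (hs : 1 ≤ s) (x : ℝ≥0∞) :
    (b : ℝ≥0∞) * (x / (b : ℝ≥0∞) ^ s) = x / (b : ℝ≥0∞) ^ (s - 1) := by
  rw [← ENNReal.mul_rpow_sub_one (b : ℝ≥0∞) hs, ← mul_div_assoc,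
    ENNReal.mul_div_mul_left _ _ (by exact_mod_cast hb) (by simp)]

variable {b : ℕ} {m : ℝ → ℝ≥0∞}

namespace IsMomentCascade

variable {Ω : Type*} [MeasurableSpace Ω] {P : Measure Ω} [IsProbabilityMeasure P]
  {U : CascadeVertex b → Ω → ℝ≥0∞}

theorem lintegral_restMass_le_one (h : IsMomentCascade U m P) (hb : b ≠ 0) (hm : m 1 = 1) (n : ℕ)
    (j : Fin b) : ∫⁻ ω, restMass n U j ω ∂P ≤ 1 := by
  have := lintegral_restMass_rpow_le (P := P) U n j zero_le_one
  simpa [lintegral_levelMass hb hm (n + 1) h] using this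

theorem lintegral_branchMass_le_one (h : IsMomentCascade U m P) (hb : b ≠ 0) (hm : m 1 = 1) (n : ℕ)
    (j : Fin b) : ∫⁻ ω, branchMass n U j ω ∂P ≤ 1 := by
  rw [h.lintegral_branchMass hb hm, ENNReal.inv_le_one]
  exact_mod_cast Nat.one_le_iff_ne_zero.2 hb

theorem lintegral_levelMass_succ_rpow_le (h : IsMomentCascade U m P) (hb : b ≠ 0) (hm : m 1 = 1)
    (n : ℕ) {p c : ℝ} (hp : 0 < p) {K A B : ℝ≥0∞}
    (hK : ∀ x r : ℝ≥0∞, (x + r) ^ p ≤ ENNReal.ofReal c * x ^ p + K * r ^ p)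
    (hA : ∀ j, ∫⁻ ω, levelMass n (fun v => U (childVertex j v)) ω ^ (p + 1) ∂P ≤ A)
    (hB : ∫⁻ ω, levelMass (n + 1) U ω ^ p ∂P ≤ B) :
    ∫⁻ ω, levelMass (n + 1) U ω ^ (p + 1) ∂P ≤
      ENNReal.ofReal c * (m (p + 1) / (b : ℝ≥0∞) ^ p) * A + b * (K * B) := by
  have hX := h.measurable_branchMass n
  have hR := h.measurable_restMass n
  have hj : ∀ j, ∫⁻ ω, branchMass n U j ω * (branchMass n U j ω + restMass n U j ω) ^ p ∂P ≤
      ENNReal.ofReal c * (m (p + 1) / (b : ℝ≥0∞) ^ (p + 1) * A) + K * B := by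
    intro j
    calc ∫⁻ ω, branchMass n U j ω * (branchMass n U j ω + restMass n U j ω) ^ p ∂P
        ≤ ∫⁻ ω, (ENNReal.ofReal c * branchMass n U j ω ^ (p + 1) +
            K * (branchMass n U j ω * restMass n U j ω ^ p)) ∂P := by
          gcongr with ω
          refine (mul_le_mul_right (hK _ _) _).trans_eq ?_
          have := ENNReal.mul_rpow_sub_one (branchMass n U j ω) (p := p + 1) (by linarith)
          rw [← this, add_sub_cancel_right]
          ring
      _ = ENNReal.ofReal c * ∫⁻ ω, branchMass n U j ω ^ (p + 1) ∂P +
            K * ((∫⁻ ω, branchMass n U j ω ∂P) * ∫⁻ ω, restMass n U j ω ^ p ∂P) := by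
          have hXR : Measurable fun ω => branchMass n U j ω * restMass n U j ω ^ p :=
            (hX j).mul ((hR j).pow_const p)
          rw [lintegral_add_left (((hX j).pow_const _).const_mul _),
            lintegral_const_mul _ ((hX j).pow_const _), lintegral_const_mul _ hXR,
            h.lintegral_branchMass_mul_restMass n j (f := fun x => x) (g := fun x => x ^ p)
              measurable_id (measurable_id.pow_const p)]
      _ ≤ ENNReal.ofReal c * (m (p + 1) / (b : ℝ≥0∞) ^ (p + 1) * A) + K * (1 * B) := by
          rw [h.lintegral_branchMass_rpow n j (by linarith)]
          gcongr
          · exact hA j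
          · exact h.lintegral_branchMass_le_one hb hm n j
          · exact (lintegral_restMass_rpow_le U n j hp.le).trans hB
      _ = _ := by rw [one_mul]
  rw [h.lintegral_levelMass_succ_rpow n hp.le]
  refine (Finset.sum_le_sum fun j _ => hj j).trans_eq ?_
  simp only [Finset.sum_const, Finset.card_univ, Fintype.card_fin, nsmul_eq_mul]
  have := ENNReal.natCast_mul_div_rpow hb (s := p + 1) (by linarith) (m (p + 1))
  rw [add_sub_cancel_right] at this
  rw [← this]
  ring

/-- Criticality gives each branch weight `1/b` on `A`, so the `b` branches contribute exactly `A`;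
independence reduces the cross terms to moments of order 1 and `p`. -/
theorem lintegral_levelMass_succ_rpow_le_add (h : IsMomentCascade U m P) (hb : b ≠ 0)
    (hm : m 1 = 1) (n : ℕ) {p : ℝ} (hp : 1 ≤ p) (hmp : m (p + 1) = (b : ℝ≥0∞) ^ p) {A B : ℝ≥0∞}
    (hA : ∀ j, ∫⁻ ω, levelMass n (fun v => U (childVertex j v)) ω ^ (p + 1) ∂P ≤ A)
    (hB : ∫⁻ ω, levelMass (n + 1) U ω ^ p ∂P ≤ B) :
    ∫⁻ ω, levelMass (n + 1) U ω ^ (p + 1) ∂P ≤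
      A + b * (ENNReal.ofReal p * 2 ^ (p - 1) * (B + B)) := by
  have hX := h.measurable_branchMass n
  have hR := h.measurable_restMass n
  have hj : ∀ j, ∫⁻ ω, branchMass n U j ω * (branchMass n U j ω + restMass n U j ω) ^ p ∂P ≤
      (b : ℝ≥0∞) ^ p / (b : ℝ≥0∞) ^ (p + 1) * A + ENNReal.ofReal p * 2 ^ (p - 1) * (B + B) := by
    intro j
    calc ∫⁻ ω, branchMass n U j ω * (branchMass n U j ω + restMass n U j ω) ^ p ∂P
        ≤ ∫⁻ ω, (branchMass n U j ω ^ (p + 1) + ENNReal.ofReal p * 2 ^ (p - 1) *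
            (branchMass n U j ω ^ p * restMass n U j ω +
              branchMass n U j ω * restMass n U j ω ^ p)) ∂P := by
          gcongr with ω
          exact ENNReal.mul_add_rpow_le hp _ _
      _ = ∫⁻ ω, branchMass n U j ω ^ (p + 1) ∂P + ENNReal.ofReal p * 2 ^ (p - 1) *
            ((∫⁻ ω, branchMass n U j ω ^ p ∂P) * (∫⁻ ω, restMass n U j ω ∂P) +
              (∫⁻ ω, branchMass n U j ω ∂P) * ∫⁻ ω, restMass n U j ω ^ p ∂P) := by
          have hXR : Measurable fun ω => branchMass n U j ω ^ p * restMass n U j ω :=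
            ((hX j).pow_const p).mul (hR j)
          have hXR' : Measurable fun ω => branchMass n U j ω * restMass n U j ω ^ p :=
            (hX j).mul ((hR j).pow_const p)
          have hsum : Measurable fun ω => branchMass n U j ω ^ p * restMass n U j ω +
              branchMass n U j ω * restMass n U j ω ^ p := hXR.add hXR'
          rw [lintegral_add_left ((hX j).pow_const _), lintegral_const_mul _ hsum,
            lintegral_add_left hXR,
            h.lintegral_branchMass_mul_restMass n j (f := fun x => x) (g := fun x => x ^ p)
              measurable_id (measurable_id.pow_const p),
            h.lintegral_branchMass_mul_restMass n j (f := fun x => x ^ p) (g := fun x => x)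
              (measurable_id.pow_const p) measurable_id]
      _ ≤ (b : ℝ≥0∞) ^ p / (b : ℝ≥0∞) ^ (p + 1) * A +
            ENNReal.ofReal p * 2 ^ (p - 1) * (B * 1 + 1 * B) := by
          rw [h.lintegral_branchMass_rpow n j (by linarith), hmp]
          gcongr
          · exact hA j
          · exact (lintegral_branchMass_rpow_le U n j (by linarith)).trans hB
          · exact h.lintegral_restMass_le_one hb hm n j
          · exact h.lintegral_branchMass_le_one hb hm n j
          · exact (lintegral_restMass_rpow_le U n j (by linarith)).trans hB
      _ = _ := by rw [one_mul, mul_one]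
  rw [h.lintegral_levelMass_succ_rpow n (by linarith)]
  refine (Finset.sum_le_sum fun j _ => hj j).trans_eq ?_
  simp only [Finset.sum_const, Finset.card_univ, Fintype.card_fin, nsmul_eq_mul]
  have := ENNReal.natCast_mul_div_rpow hb (s := p + 1) (by linarith) ((b : ℝ≥0∞) ^ p)
  rw [add_sub_cancel_right, ENNReal.div_self (by simp [hb]) (by finiteness)] at this
  rw [mul_add, ← mul_assoc, this, one_mul]

theorem le_lintegral_restMass_rpow (h : IsMomentCascade U m P) (hb : 2 ≤ b) (hm : m 1 = 1)
    (n : ℕ) (j : Fin b) {p : ℝ} (hp : 1 ≤ p) :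
    4⁻¹ / 4 ^ (p - 1) ≤ ∫⁻ ω, restMass n U j ω ^ p ∂P := by
  have hb0 : b ≠ 0 := by omega
  have hR := h.measurable_restMass n j
  have h1 : (1 : ℝ≥0∞) ≤ 2⁻¹ + ∫⁻ ω, restMass n U j ω ∂P := by
    have e := lintegral_levelMass hb0 hm (n + 1) h
    simp only [levelMass_succ_eq_add n U j] at e
    rw [lintegral_add_left (h.measurable_branchMass n j), h.lintegral_branchMass hb0 hm] at e
    rw [← e]
    gcongr
    exact_mod_cast hb
  have h2 : (2 : ℝ≥0∞)⁻¹ ≤ ∫⁻ ω, restMass n U j ω ∂P := by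
    rw [← ENNReal.inv_two_add_inv_two] at h1
    exact (ENNReal.add_le_add_iff_left (by simp)).1 h1
  have h3 : (2 : ℝ≥0∞)⁻¹ ≤ 4⁻¹ + 4 ^ (p - 1) * ∫⁻ ω, restMass n U j ω ^ p ∂P := by
    refine (h2.trans (lintegral_mono fun ω => ENNReal.le_inv_four_add hp _)).trans_eq ?_
    rw [lintegral_add_left measurable_const, lintegral_const_mul _ (hR.pow_const p)]
    simp
  have h4 : (2 : ℝ≥0∞)⁻¹ = 4⁻¹ + 4⁻¹ := by
    rw [← two_mul, show (4 : ℝ≥0∞) = 2 * 2 by norm_num,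
      ENNReal.mul_inv (by simp) (by simp), ← mul_assoc,
      ENNReal.mul_inv_cancel (by simp) (by simp), one_mul]
  rw [h4] at h3
  exact ENNReal.div_le_of_le_mul' ((ENNReal.add_le_add_iff_left (by simp)).1 h3)

theorem add_le_lintegral_levelMass_succ_rpow (h : IsMomentCascade U m P) (hb : 2 ≤ b)
    (hm : m 1 = 1) (n : ℕ) {p : ℝ} (hp : 1 ≤ p) (hmp : m (p + 1) = (b : ℝ≥0∞) ^ p) {A : ℝ≥0∞}
    (hA : ∀ j, A ≤ ∫⁻ ω, levelMass n (fun v => U (childVertex j v)) ω ^ (p + 1) ∂P) :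
    A + 4⁻¹ / 4 ^ (p - 1) ≤ ∫⁻ ω, levelMass (n + 1) U ω ^ (p + 1) ∂P := by
  have hb0 : b ≠ 0 := by omega
  have hX := h.measurable_branchMass n
  have hR := h.measurable_restMass n
  have hj : ∀ j, (b : ℝ≥0∞) ^ p / (b : ℝ≥0∞) ^ (p + 1) * A + (b : ℝ≥0∞)⁻¹ * (4⁻¹ / 4 ^ (p - 1)) ≤
      ∫⁻ ω, branchMass n U j ω * (branchMass n U j ω + restMass n U j ω) ^ p ∂P := by
    intro j
    calc _ ≤ ∫⁻ ω, branchMass n U j ω ^ (p + 1) ∂P +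
            (∫⁻ ω, branchMass n U j ω ∂P) * ∫⁻ ω, restMass n U j ω ^ p ∂P := by
          rw [h.lintegral_branchMass_rpow n j (by linarith), hmp, h.lintegral_branchMass hb0 hm]
          gcongr
          · exact hA j
          · exact h.le_lintegral_restMass_rpow hb hm n j hp
      _ = ∫⁻ ω, (branchMass n U j ω ^ (p + 1) + branchMass n U j ω * restMass n U j ω ^ p) ∂P := by
          rw [lintegral_add_left ((hX j).pow_const _),
            h.lintegral_branchMass_mul_restMass n j (f := fun x => x) (g := fun x => x ^ p)
              measurable_id (measurable_id.pow_const p)]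
      _ ≤ _ := by
          gcongr with ω
          have := ENNReal.mul_rpow_sub_one (branchMass n U j ω) (p := p + 1) (by linarith)
          rw [← this, add_sub_cancel_right, ← mul_add]
          gcongr
          exact ENNReal.add_rpow_le_rpow_add _ _ hp
  rw [h.lintegral_levelMass_succ_rpow n (by linarith)]
  refine Eq.trans_le ?_ (Finset.sum_le_sum fun j _ => hj j)
  simp only [Finset.sum_const, Finset.card_univ, Fintype.card_fin, nsmul_eq_mul]
  have := ENNReal.natCast_mul_div_rpow hb0 (s := p + 1) (by linarith) ((b : ℝ≥0∞) ^ p)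
  rw [add_sub_cancel_right, ENNReal.div_self (by simp [hb0]) (by finiteness)] at this
  rw [mul_add, ← mul_assoc, this, one_mul, ← mul_assoc,
    ENNReal.mul_inv_cancel (by exact_mod_cast hb0) (by simp), one_mul]

end IsMomentCascade

/-- Induction in unit steps of the exponent: the moment of order `s - 1` controls the additive error
in an affine recursion for order `s`, whose slope can be kept below 1. Orders at most 1 follow from
the mean. -/
theorem exists_lintegral_levelMass_rpow_le (hb : b ≠ 0) (hm : m 1 = 1) {q : ℝ}
    (hmq : ∀ s, 1 < s → s < q → m s < (b : ℝ≥0∞) ^ (s - 1)) {s : ℝ} (hs : 0 ≤ s) (hsq : s < q) :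
    ∃ A : ℝ≥0∞, A ≠ ∞ ∧ ∀ (Ω : Type u) [MeasurableSpace Ω] (P : Measure Ω) [IsProbabilityMeasure P]
      (U : CascadeVertex b → Ω → ℝ≥0∞), IsMomentCascade U m P →
      ∀ n, ∫⁻ ω, levelMass n U ω ^ s ∂P ≤ A := by
  obtain ⟨k, hk⟩ := exists_nat_ge (s - 1)
  induction k generalizing s with
  | zero =>
    refine ⟨1 + 1, by finiteness, fun Ω _ P _ U h n => ?_⟩
    refine (lintegral_mono fun ω =>
      ENNReal.rpow_le_one_add hs (by push_cast at hk; linarith) _).trans_eq ?_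
    rw [lintegral_add_left measurable_const, IsMomentCascade.lintegral_levelMass hb hm n h]
    simp
  | succ k ih =>
    by_cases hsk : s - 1 ≤ k
    · exact ih hs hsq hsk
    push Not at hsk
    have hs1 : 0 < s - 1 := lt_of_le_of_lt (Nat.cast_nonneg k) hsk
    obtain ⟨B, hB, hUB⟩ := ih hs1.le (by linarith) (by push_cast at hk; linarith)
    have hρ : m s / (b : ℝ≥0∞) ^ (s - 1) < 1 :=
      ENNReal.div_lt_of_lt_mul (by rw [one_mul]; exact hmq s (by linarith) hsq)
    obtain ⟨c, hc, hcρ⟩ := ENNReal.exists_one_lt_mul_lt_one hρ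
    obtain ⟨K, hK, hKle⟩ := ENNReal.add_rpow_le_const_mul_rpow_add hs1 hc
    obtain ⟨A, hA, hA1, hAle⟩ := ENNReal.exists_affine_bound hcρ (k := b * (K * B)) (by finiteness)
    refine ⟨A, hA, fun Ω _ P _ U h n => ?_⟩
    induction n generalizing U with
    | zero => simpa [levelMass] using hA1
    | succ n ihn =>
      have := h.lintegral_levelMass_succ_rpow_le hb hm n hs1 hKle (A := A) (B := B)
        (fun j => by rw [sub_add_cancel]; exact ihn _ (h.child j)) (hUB Ω P U h (n + 1))
      rw [sub_add_cancel] at this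
      exact this.trans hAle

theorem exists_lintegral_levelMass_rpow_linear_bounds (hb : 2 ≤ b) (hm : m 1 = 1) {q : ℝ}
    (hq : 2 ≤ q) (hmq : ∀ s, 1 < s → s < q → m s < (b : ℝ≥0∞) ^ (s - 1))
    (hmqq : m q = (b : ℝ≥0∞) ^ (q - 1)) :
    ∃ κ D : ℝ≥0∞, κ ≠ 0 ∧ κ ≠ ∞ ∧ D ≠ ∞ ∧
      ∀ (Ω : Type u) [MeasurableSpace Ω] (P : Measure Ω) [IsProbabilityMeasure P]
      (U : CascadeVertex b → Ω → ℝ≥0∞), IsMomentCascade U m P →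
      ∀ n : ℕ, 1 + n * κ ≤ ∫⁻ ω, levelMass n U ω ^ q ∂P ∧
        ∫⁻ ω, levelMass n U ω ^ q ∂P ≤ 1 + n * D := by
  have hb0 : b ≠ 0 := by omega
  obtain ⟨p, rfl⟩ : ∃ p, q = p + 1 := ⟨q - 1, by ring⟩
  have hp : 1 ≤ p := by linarith
  rw [add_sub_cancel_right] at hmqq
  obtain ⟨B, hB, hUB⟩ :=
    exists_lintegral_levelMass_rpow_le.{u} hb0 hm hmq (s := p) (by linarith) (by linarith)
  have hp1 : 0 ≤ p - 1 := by linarith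
  refine ⟨4⁻¹ / 4 ^ (p - 1), b * (ENNReal.ofReal p * 2 ^ (p - 1) * (B + B)), ?_, ?_, ?_, ?_⟩
  · refine (ENNReal.div_pos (by simp) (by finiteness)).ne'
  · exact ENNReal.div_ne_top (by simp) (by simp)
  · finiteness
  intro Ω _ P _ U h n
  induction n generalizing U with
  | zero => simp [levelMass]
  | succ n ih =>
    have h1 := h.add_le_lintegral_levelMass_succ_rpow hb hm n hp hmqq
      fun j => (ih _ (h.child j)).1
    have h2 := h.lintegral_levelMass_succ_rpow_le_add hb0 hm n hp hmqq
      (fun j => (ih _ (h.child j)).2) (hUB Ω P U h (n + 1))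
    push_cast
    rw [add_mul, add_mul, one_mul, one_mul, ← add_assoc, ← add_assoc]
    exact ⟨h1, h2⟩

theorem tendsto_log_div_log_of_linear_bounds {a : ℕ → ℝ} {c C : ℝ} (hc : 0 < c)
    (hC : 0 < C) (ha : ∀ n : ℕ, 1 ≤ n → c * n ≤ a n ∧ a n ≤ C * n) :
    Tendsto (fun n : ℕ => Real.log (a n) / Real.log n) atTop (𝓝 1) := by
  have hlog : Tendsto (fun n : ℕ => Real.log n) atTop atTop :=
    Real.tendsto_log_atTop.comp tendsto_natCast_atTop_atTop
  have h : ∀ d : ℝ, Tendsto (fun n : ℕ => Real.log d / Real.log n + 1) atTop (𝓝 1) := fun d => by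
    simpa using (hlog.const_div_atTop (Real.log d)).add_const 1
  have heq : ∀ {d : ℝ}, 0 < d → ∀ {n : ℕ}, 2 ≤ n →
      Real.log d / Real.log n + 1 = Real.log (d * n) / Real.log n := by
    intro d hd n hn
    have hn' : (1 : ℝ) < n := by exact_mod_cast hn
    have := Real.log_pos hn'
    rw [Real.log_mul hd.ne' (by positivity), add_div, div_self this.ne']
  refine tendsto_of_tendsto_of_tendsto_of_le_of_le' (h c) (h C) ?_ ?_
  all_goals
    filter_upwards [eventually_ge_atTop 2] with n hn
    have hn' : (1 : ℝ) < n := by exact_mod_cast hn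
    have hl := Real.log_pos hn'
    obtain ⟨h1, h2⟩ := ha n (by omega)
    have hcn : 0 < c * n := by positivity
  · rw [heq hc hn]
    gcongr
  · rw [heq hC hn]
    gcongr
    exact hcn.trans_le h1

end MomentBounds

/-! ### Transfer to real-valued weights and conclusion -/

theorem IsIndepCopies.isMomentCascade {b : ℕ} {Ω₀ Ω : Type*} [MeasurableSpace Ω₀]
    [MeasurableSpace Ω] {P₀ : Measure Ω₀} {W : Ω₀ → ℝ} {P : Measure Ω}
    {V : CascadeVertex b → Ω → ℝ} (h : IsIndepCopies W P₀ V P) :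
    IsMomentCascade (fun v ω => ENNReal.ofReal (V v ω))
      (fun s => ∫⁻ x, ENNReal.ofReal (W x) ^ s ∂P₀) P where
  measurable v := (h.measurable v).ennreal_ofReal
  indep := h.indep.comp (fun _ => ENNReal.ofReal) fun _ => ENNReal.measurable_ofReal
  moment v s :=
    ((h.identDistrib v).comp (ENNReal.measurable_ofReal.pow_const s)).lintegral_eq

theorem measurable_cascadeMass {b : ℕ} {Ω : Type*} [MeasurableSpace Ω]
    {V : CascadeVertex b → Ω → ℝ} (hV : ∀ v, Measurable (V v)) (n : ℕ) :
    Measurable (cascadeMass V n) :=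
  (Finset.measurable_fun_sum _ fun _ _ => Finset.measurable_fun_prod _ fun _ _ => hV _).const_mul _

theorem theorem2 (b : ℕ) (hb : 2 ≤ b)
    {Ω₀ : Type*} [MeasurableSpace Ω₀] (P₀ : Measure Ω₀) [IsProbabilityMeasure P₀]
    (W : Ω₀ → ℝ) (hW_meas : Measurable W) (hW_nonneg : ∀ᵐ x ∂P₀, 0 ≤ W x)
    (hW_int : Integrable W P₀) (hW_mean : ∫ x, W x ∂P₀ = 1)
    (hW_not_critical : P₀.map W ≠ totallyCriticalLaw b)
    (q : ℝ) (hq : 2 ≤ q)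
    (hWq_int : Integrable (fun x => W x ^ q) P₀)
    (hWq : ∫ x, W x ^ q ∂P₀ = (b : ℝ) ^ (q - 1)) :
    ∃ c C : ℝ, 0 < c ∧ 0 < C ∧
      ∀ (Ω : Type*) [MeasurableSpace Ω] (P : Measure Ω) [IsProbabilityMeasure P]
        (V : CascadeVertex b → Ω → ℝ), IsIndepCopies W P₀ V P →
        (∀ n : ℕ, Integrable (fun ω => cascadeMass V n ω ^ q) P) ∧
        Tendsto (fun n : ℕ => Real.log (∫ ω, cascadeMass V n ω ^ q ∂P) / Real.log n)
          atTop (𝓝 1) ∧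
        ∀ n : ℕ, 1 ≤ n →
          c * n ≤ ∫ ω, cascadeMass V n ω ^ q ∂P ∧ ∫ ω, cascadeMass V n ω ^ q ∂P ≤ C * n := by
  have hb0 : (0 : ℝ) < b := by exact_mod_cast (by omega : 0 < b)
  have hm1 : ∫⁻ x, ENNReal.ofReal (W x) ^ (1 : ℝ) ∂P₀ = 1 := by
    simp only [ENNReal.rpow_one]
    rw [← ofReal_integral_eq_lintegral_ofReal hW_int hW_nonneg, hW_mean, ENNReal.ofReal_one]
  have hmq : ∫⁻ x, ENNReal.ofReal (W x) ^ q ∂P₀ = (b : ℝ≥0∞) ^ (q - 1) := by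
    rw [← ENNReal.ofReal_natCast, ENNReal.ofReal_rpow_of_pos hb0, ← hWq,
      ofReal_integral_eq_lintegral_ofReal hWq_int]
    · refine lintegral_congr_ae ?_
      filter_upwards [hW_nonneg] with x hx using ENNReal.ofReal_rpow_of_nonneg hx (by linarith)
    · filter_upwards [hW_nonneg] with x hx using Real.rpow_nonneg hx q
  obtain ⟨κ, D, hκ0, hκ, hD, hbounds⟩ := exists_lintegral_levelMass_rpow_linear_bounds
    (m := fun s => ∫⁻ x, ENNReal.ofReal (W x) ^ s ∂P₀) hb hm1 hq
    (fun s hs hsq => lintegral_rpow_lt_of_not_totallyCritical hb P₀ W hW_meas hW_nonneg hW_int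
      hW_mean hW_not_critical q hWq_int hWq hs hsq) hmq
  refine ⟨κ.toReal, 1 + D.toReal, ENNReal.toReal_pos hκ0 hκ, by positivity,
    fun Ω _ P _ V hV => ?_⟩
  have hnonneg : ∀ᵐ ω ∂P, ∀ v, 0 ≤ V v ω := by
    -- The tree has countably many vertices, so one null set serves all weights.
    rw [ae_all_iff]
    exact fun v => (hV.identDistrib v).symm.ae_snd (p := fun x => 0 ≤ x) measurableSet_Ici hW_nonneg
  have hpow_nonneg : ∀ n, 0 ≤ᵐ[P] fun ω => cascadeMass V n ω ^ q := fun n => by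
    filter_upwards [hnonneg] with ω hω using
      Real.rpow_nonneg (cascadeMass_nonneg_and_ofReal n ω V hω).1 q
  have hmeas : ∀ n, AEStronglyMeasurable (fun ω => cascadeMass V n ω ^ q) P := fun n =>
    ((measurable_cascadeMass hV.measurable n).pow_const q).aestronglyMeasurable
  have hlint : ∀ n, ∫⁻ ω, ENNReal.ofReal (cascadeMass V n ω ^ q) ∂P =
      ∫⁻ ω, levelMass n (fun v ω => ENNReal.ofReal (V v ω)) ω ^ q ∂P := fun n => by
    refine lintegral_congr_ae ?_
    filter_upwards [hnonneg] with ω hω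
    obtain ⟨h1, h2⟩ := cascadeMass_nonneg_and_ofReal n ω V hω
    rw [← h2, ENNReal.ofReal_rpow_of_nonneg h1 (by linarith)]
  have hbd := hbounds Ω P _ hV.isMomentCascade
  have hfin : ∀ n : ℕ, (1 + n * D : ℝ≥0∞) ≠ ∞ := fun n => by finiteness
  have hlinear : ∀ n : ℕ, 1 ≤ n → κ.toReal * n ≤ ∫ ω, cascadeMass V n ω ^ q ∂P ∧
      ∫ ω, cascadeMass V n ω ^ q ∂P ≤ (1 + D.toReal) * n := by
    intro n hn
    rw [integral_eq_lintegral_of_nonneg_ae (hpow_nonneg n) (hmeas n), hlint]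
    have hn' : (1 : ℝ) ≤ n := by exact_mod_cast hn
    obtain ⟨h1, h2⟩ := hbd n
    have h1' := ENNReal.toReal_mono (ne_top_of_le_ne_top (hfin n) h2) h1
    have h2' := ENNReal.toReal_mono (hfin n) h2
    rw [ENNReal.toReal_add (by simp) (by finiteness), ENNReal.toReal_mul, ENNReal.toReal_natCast,
      ENNReal.toReal_one] at h1' h2'
    -- The lower bound drops the initial 1; the upper one absorbs it using `1 ≤ n`.
    constructor <;> linarith
  refine ⟨fun n => ⟨hmeas n, ?_⟩,
    tendsto_log_div_log_of_linear_bounds (ENNReal.toReal_pos hκ0 hκ) (by positivity) hlinear,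
    hlinear⟩
  rw [hasFiniteIntegral_iff_ofReal (hpow_nonneg n), hlint]
  exact (hbd n).2.trans_lt (hfin n).lt_top
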